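/- Let $a>0$, $c\neq 0$, $\rho\in[-1,1]$ and $t>0$ be real numbers, and put $$p(z)=(a-\rho c z)^2+c^2(z-z^2),\qquad L_1(z)=\sum_{n=0}^\infty\frac{z^n}{(2n)!},\qquad L_2(z)=\sum_{n=0}^\infty\frac{z^n}{(2n+1)!}\qquad(z\in\mathbb C),$$ so that $L_1$ and $L_2$ are the entire extensions of $\cosh\sqrt z$ and $\sinh\sqrt z/\sqrt z$. Then the function $$F(z)=L_1\!\left(\frac{p(z)t^2}{4}\right)+(a-c\rho z)\,\frac t2\,L_2\!\left(\frac{p(z)t^2}{4}\right)$$ is entire, and all of its zeros in $\mathbb C$ are real and simple. -/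

import Mathlib

namespace Heston

/-- The entire function `L₁(z) = ∑ zⁿ / (2n)!`, i.e. the entire extension of `cosh √z`. -/
noncomputable def L₁ (z : ℂ) : ℂ := ∑' n : ℕ, z ^ n / ((2 * n).factorial : ℂ)

/-- The entire function `L₂(z) = ∑ zⁿ / (2n+1)!`, i.e. the entire extension of `sinh √z / √z`. -/
noncomputable def L₂ (z : ℂ) : ℂ := ∑' n : ℕ, z ^ n / ((2 * n + 1).factorial : ℂ)

/-- `L₁` is `cosh √z` for every choice `w` of the square root. -/
theorem L₁_sq (w : ℂ) : L₁ (w ^ 2) = Complex.cosh w := by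
  rw [L₁, Complex.cosh_eq_tsum]
  simp only [pow_mul]

/-- `L₂` is `sinh √z / √z` for every choice `w` of the square root. -/
theorem mul_L₂_sq (w : ℂ) : w * L₂ (w ^ 2) = Complex.sinh w := by
  rw [L₂, Complex.sinh_eq_tsum, ← tsum_mul_left]
  refine tsum_congr fun n => ?_
  rw [pow_succ w (2 * n), pow_mul]
  ring

/-- The polynomial `p(z) = (a - ρ c z)² + c² (z - z²)`. -/
noncomputable def p (a c ρ : ℝ) (z : ℂ) : ℂ :=
  ((a : ℂ) - ρ * c * z) ^ 2 + (c : ℂ) ^ 2 * (z - z ^ 2)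

/-- The function `F(z) = cosh (P(z) t / 2) + (a - c ρ z) sinh (P(z) t / 2) / P(z)`, where
`P(z) = √(p(z))`, extended to the whole complex plane by means of `L₁` and `L₂`. -/
noncomputable def F (a c ρ t : ℝ) (z : ℂ) : ℂ :=
  L₁ (p a c ρ z * (t : ℂ) ^ 2 / 4) +
    ((a : ℂ) - c * ρ * z) * ((t : ℂ) / 2) * L₂ (p a c ρ z * (t : ℂ) ^ 2 / 4)

/-- The defining formula of `F` away from the zeros of `p`, for every choice `P` of the square
root of `p(z)`. -/
theorem F_eq (a c ρ t : ℝ) (z P : ℂ) (hP : P ^ 2 = p a c ρ z) (h0 : P ≠ 0) :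
    F a c ρ t z = Complex.cosh (P * t / 2) +
      ((a : ℂ) - c * ρ * z) * (Complex.sinh (P * t / 2) / P) := by
  have h : p a c ρ z * (t : ℂ) ^ 2 / 4 = (P * t / 2) ^ 2 := by rw [← hP]; ring
  rw [F, h, L₁_sq, ← mul_L₂_sq]
  field_simp

end Heston

open Complex ComplexConjugate

namespace Heston

/-! As a function of `t`, `F` is the solution `y` of `y'' = (p(z)/4) y`, `y(0) = 1`, `y'(0) = (a -
cρz)/2`, so a Sturm-type argument applies. For non-real `z`, the quantity `-Im(z̄ y' ȳ)/Im z` starts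
at `a/2 > 0` and increases because `ρ² ≤ 1`, so `y(t) ≠ 0` (`solution_ne_zero`). Its limit as `z`
tends to a real `x` is `y'y + x(w y' - w' y)` with `w = ∂y/∂x`; it behaves the same way, so `y` and
`w` have no common zero and real zeros are simple (`solution_param_ne_zero`). -/

/-! ### Differential identities for `L₁` and `L₂` -/

theorem differentiable_tsum_pow_div_factorial (k : ℕ) :
    Differentiable ℂ fun z : ℂ => ∑' n : ℕ, z ^ n / ((2 * n + k).factorial : ℂ) := by
  intro z
  have hz : z ∈ Metric.ball (0 : ℂ) (‖z‖ + 1) := by simp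
  refine DifferentiableOn.differentiableAt (s := Metric.ball (0 : ℂ) (‖z‖ + 1)) ?_
    (Metric.isOpen_ball.mem_nhds hz)
  refine differentiableOn_tsum_of_summable_norm
    (u := fun n : ℕ => (‖z‖ + 1) ^ n / (n.factorial : ℝ))
    (Real.summable_pow_div_factorial _) (fun n => ?_) Metric.isOpen_ball (fun n x hx => ?_)
  · fun_prop
  · rw [norm_div, norm_pow, Complex.norm_natCast]
    have hx' : ‖x‖ ≤ ‖z‖ + 1 := by simpa using (Metric.mem_ball.1 hx).le
    have hn : (n.factorial : ℝ) ≤ ((2 * n + k).factorial : ℝ) := by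
      exact_mod_cast Nat.factorial_le (by omega)
    have : (0 : ℝ) < n.factorial := by exact_mod_cast n.factorial_pos
    gcongr

theorem differentiable_L₁ : Differentiable ℂ L₁ := differentiable_tsum_pow_div_factorial 0

theorem differentiable_L₂ : Differentiable ℂ L₂ := differentiable_tsum_pow_div_factorial 1

theorem differentiable_deriv_L₂ : Differentiable ℂ (deriv L₂) := differentiable_L₂.deriv

theorem deriv_L₁ (x : ℂ) : deriv L₁ x = L₂ x / 2 := by
  have hc : Continuous (deriv L₁) := differentiable_L₁.deriv.continuous
  have hc' : Continuous fun x => L₂ x / 2 := differentiable_L₂.continuous.div_const 2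
  -- Differentiating `L₁_sq` gives the identity multiplied by `w`, which cancels only for `w ≠ 0`;
  -- continuity covers the origin.
  refine congrFun (Continuous.ext_on (dense_compl_singleton (0 : ℂ)) hc hc' fun x hx => ?_) x
  obtain ⟨w, rfl⟩ : ∃ w : ℂ, w ^ 2 = x := IsAlgClosed.exists_pow_nat_eq x two_pos
  have hw : w ≠ 0 := by rintro rfl; simp at hx
  have h := (differentiable_L₁ (w ^ 2)).hasDerivAt.comp w (hasDerivAt_pow 2 w)
  have h' : HasDerivAt (L₁ ∘ fun w => w ^ 2) (Complex.sinh w) w := by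
    rw [show (L₁ ∘ fun w => w ^ 2) = Complex.cosh from funext L₁_sq]
    exact Complex.hasDerivAt_cosh w
  have e := h.unique h'
  rw [← mul_L₂_sq] at e
  apply mul_left_cancel₀ hw
  push_cast at e
  linear_combination e / 2

theorem L₂_add_deriv (x : ℂ) : L₂ x + 2 * x * deriv L₂ x = L₁ x := by
  obtain ⟨w, rfl⟩ : ∃ w : ℂ, w ^ 2 = x := IsAlgClosed.exists_pow_nat_eq x two_pos
  have h := (hasDerivAt_id w).mul
    ((differentiable_L₂ (w ^ 2)).hasDerivAt.comp w (hasDerivAt_pow 2 w))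
  have h' : HasDerivAt (fun w => w * L₂ (w ^ 2)) (Complex.cosh w) w := by
    rw [funext mul_L₂_sq]
    exact Complex.hasDerivAt_sinh w
  have e := HasDerivAt.unique h h'
  rw [← L₁_sq] at e
  simp only [id, Function.comp] at e
  push_cast at e
  linear_combination e

theorem deriv_L₂_add_deriv (x : ℂ) :
    3 * deriv L₂ x + 2 * x * deriv (deriv L₂) x = L₂ x / 2 := by
  have h := (differentiable_L₂ x).hasDerivAt.add
    (((hasDerivAt_id x).const_mul 2).mul (differentiable_deriv_L₂ x).hasDerivAt)
  have h' : HasDerivAt (fun x => L₂ x + 2 * x * deriv L₂ x) (L₂ x / 2) x := by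
    rw [funext L₂_add_deriv, ← deriv_L₁]
    exact (differentiable_L₁ x).hasDerivAt
  have e := HasDerivAt.unique h h'
  simp only [id] at e
  linear_combination e

/-! ### Fundamental solutions and their dependence on `q` -/

/-- The solution of `y'' = (q / 4) y` with `y(0) = 1` and `y'(0) = 0`. -/
noncomputable def cosSol (q s : ℂ) : ℂ := L₁ (q * s ^ 2 / 4)

/-- The solution of `y'' = (q / 4) y` with `y(0) = 0` and `y'(0) = 1`. -/
noncomputable def sinSol (q s : ℂ) : ℂ := s * L₂ (q * s ^ 2 / 4)

/-- The derivative of `sinSol` with respect to the parameter `q`. -/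
noncomputable def sinSolParam (q s : ℂ) : ℂ := s ^ 3 / 4 * deriv L₂ (q * s ^ 2 / 4)

theorem hasDerivAt_time (q s : ℂ) :
    HasDerivAt (fun s : ℂ => q * s ^ 2 / 4) (q * s / 2) s := by
  have h := ((hasDerivAt_pow 2 s).const_mul q).div_const 4
  refine h.congr_deriv ?_
  push_cast
  ring

theorem hasDerivAt_param (q s : ℂ) :
    HasDerivAt (fun q : ℂ => q * s ^ 2 / 4) (s ^ 2 / 4) q := by
  simpa using ((hasDerivAt_id q).mul_const (s ^ 2)).div_const 4

theorem hasDerivAt_cosSol (q s : ℂ) : HasDerivAt (cosSol q) (q / 4 * sinSol q s) s := by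
  have h := (differentiable_L₁ (q * s ^ 2 / 4)).hasDerivAt.comp s (hasDerivAt_time q s)
  rw [deriv_L₁] at h
  refine h.congr_deriv ?_
  rw [sinSol]
  ring

theorem hasDerivAt_sinSol (q s : ℂ) : HasDerivAt (sinSol q) (cosSol q s) s := by
  have h := (hasDerivAt_id s).mul
    ((differentiable_L₂ (q * s ^ 2 / 4)).hasDerivAt.comp s (hasDerivAt_time q s))
  refine h.congr_deriv ?_
  rw [cosSol, ← L₂_add_deriv]
  simp only [id, Function.comp]
  ring

theorem hasDerivAt_sinSolParam (q s : ℂ) :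
    HasDerivAt (sinSolParam q) (s * sinSol q s / 8) s := by
  have h := ((hasDerivAt_pow 3 s).div_const 4).mul
    ((differentiable_deriv_L₂ (q * s ^ 2 / 4)).hasDerivAt.comp s (hasDerivAt_time q s))
  refine h.congr_deriv ?_
  have e := deriv_L₂_add_deriv (q * s ^ 2 / 4)
  simp only [sinSol, Function.comp]
  push_cast
  linear_combination s ^ 2 / 4 * e

/-- Needed to check that the parameter derivative of `y` solves the linearized equation. -/
theorem mul_sinSolParam (q s : ℂ) :
    q * sinSolParam q s = (s * cosSol q s - sinSol q s) / 2 := by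
  have e := L₂_add_deriv (q * s ^ 2 / 4)
  simp only [sinSol, cosSol, sinSolParam]
  linear_combination s / 2 * e

theorem hasDerivAt_cosSol_param (q s : ℂ) :
    HasDerivAt (fun q => cosSol q s) (s * sinSol q s / 8) q := by
  have h := (differentiable_L₁ (q * s ^ 2 / 4)).hasDerivAt.comp q (hasDerivAt_param q s)
  rw [deriv_L₁] at h
  refine h.congr_deriv ?_
  rw [sinSol]
  ring

theorem hasDerivAt_sinSol_param (q s : ℂ) :
    HasDerivAt (fun q => sinSol q s) (sinSolParam q s) q := by
  have h := ((differentiable_L₂ (q * s ^ 2 / 4)).hasDerivAt.comp q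
    (hasDerivAt_param q s)).const_mul s
  refine h.congr_deriv ?_
  rw [sinSolParam]
  ring

theorem cosSol_zero (q : ℂ) : cosSol q 0 = 1 := by
  simpa [cosSol] using L₁_sq 0

theorem sinSol_zero (q : ℂ) : sinSol q 0 = 0 := by simp [sinSol]

theorem sinSolParam_zero (q : ℂ) : sinSolParam q 0 = 0 := by simp [sinSolParam]

/-! ### Monotone quantities that exclude zeros -/

theorem ne_zero_of_re_deriv_nonneg {f f' : ℝ → ℂ} (hf : ∀ s, HasDerivAt f (f' s) s)
    (hf' : ∀ s, 0 ≤ (f' s).re) (h0 : 0 < (f 0).re) {t : ℝ} (ht : 0 ≤ t) : f t ≠ 0 := by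
  intro h
  have hd : ∀ s, HasDerivAt (fun s => (f s).re) (f' s).re s := fun s =>
    Complex.reCLM.hasFDerivAt.comp_hasDerivAt s (hf s)
  have hm : Monotone fun s => (f s).re :=
    monotone_of_deriv_nonneg (fun s => (hd s).differentiableAt) fun s => by
      rw [(hd s).deriv]
      exact hf' s
  have := hm ht
  simp only [h, Complex.zero_re] at this
  linarith

section Sturm

variable {y v w u : ℝ → ℂ} {t : ℝ}

/-- Let `z` be non-real. A solution of `y'' = P y`, `y 0 = 1`, `y' 0 = B` has no zero on the
half-line if `-Im (conj z * P) / Im z` is nonnegative and `-Im (conj z * B) / Im z` is positive. -/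
theorem solution_ne_zero {z B P : ℂ} {a γ : ℝ} (hz : z.im ≠ 0) (hy : ∀ s, HasDerivAt y (v s) s)
    (hv : ∀ s, HasDerivAt v (P * y s) s) (hy0 : y 0 = 1) (hv0 : v 0 = B)
    (hB : (conj z * B).im = -z.im * a) (ha : 0 < a)
    (hP : (conj z * P).im = -z.im * γ) (hγ : 0 ≤ γ) (ht : 0 ≤ t) : y t ≠ 0 := by
  intro hyt
  -- The real part is `-Im(z̄ v ȳ)/Im z`, with derivative `γ|y|² + |v|²` and initial value `a`.
  refine ne_zero_of_re_deriv_nonneg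
    (f := fun s => I / z.im * conj z * (v s * conj (y s)))
    (fun s => ((hv s).mul (hy s).star).const_mul _) (fun s => ?_) ?_ ht ?_
  · have e : I / z.im * conj z * (P * y s * star (y s) + v s * star (v s)) =
        I / z.im * ((conj z * P) * (normSq (y s) : ℝ) + conj z * (normSq (v s) : ℝ)) := by
      rw [Complex.normSq_eq_conj_mul_self, Complex.normSq_eq_conj_mul_self]
      simp only [← starRingEnd_apply]
      ring
    have e2 : (I / z.im * ((conj z * P) * (normSq (y s) : ℝ) +
        conj z * (normSq (v s) : ℝ))).re = γ * normSq (y s) + normSq (v s) := by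
      rw [div_mul_eq_mul_div, Complex.div_ofReal_re, Complex.I_mul_re, Complex.add_im,
        Complex.im_mul_ofReal, Complex.im_mul_ofReal, hP, Complex.conj_im]
      field_simp
      ring
    change 0 ≤ (I / z.im * conj z * (P * y s * star (y s) + v s * star (v s))).re
    rw [e, e2]
    have := Complex.normSq_nonneg (y s)
    have := Complex.normSq_nonneg (v s)
    positivity
  · have e : (I / z.im * conj z * (v 0 * conj (y 0))).re = a := by
      rw [hy0, hv0, map_one, mul_one, mul_assoc, div_mul_eq_mul_div, Complex.div_ofReal_re,
        Complex.I_mul_re, hB]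
      field_simp
    change 0 < (I / z.im * conj z * (v 0 * conj (y 0))).re
    rwa [e]
  · simp [hyt]

/-- If `w` is the derivative of the solution `y` of `y'' = P y` with respect to a real parameter
`x`, and `Q` is the derivative of the coefficient `P`, then `w` and `y` do not vanish together. -/
theorem solution_param_ne_zero {x B B' P Q : ℝ} (hy : ∀ s, HasDerivAt y (v s) s)
    (hv : ∀ s, HasDerivAt v (P * y s) s) (hw : ∀ s, HasDerivAt w (u s) s)
    (hu : ∀ s, HasDerivAt u (P * w s + Q * y s) s) (hy0 : y 0 = 1) (hv0 : v 0 = B)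
    (hw0 : w 0 = 0) (hu0 : u 0 = B') (hB : 0 < B - x * B') (hP : 0 ≤ P - x * Q)
    (ht : 0 ≤ t) (hyt : y t = 0) : w t ≠ 0 := by
  intro hwt
  -- The derivative is `(P - xQ)|y|² + |v|²`: the `x` term cancels all products of `w` or `u` with
  -- `y` or `v`.
  refine ne_zero_of_re_deriv_nonneg
    (f := fun s => v s * conj (y s) + x * (w s * conj (v s) - u s * conj (y s)))
    (fun s => ((hv s).mul (hy s).star).add
      ((((hw s).mul (hv s).star).sub ((hu s).mul (hy s).star)).const_mul (x : ℂ)))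
    (fun s => ?_) ?_ ht ?_
  · have e : P * y s * star (y s) + v s * star (v s) +
        x * (u s * star (v s) + w s * star (P * y s) -
          ((P * w s + Q * y s) * star (y s) + u s * star (v s))) =
        (((P - x * Q) * normSq (y s) + normSq (v s) : ℝ) : ℂ) := by
      push_cast
      rw [Complex.normSq_eq_conj_mul_self, Complex.normSq_eq_conj_mul_self]
      simp only [← starRingEnd_apply, map_mul, Complex.conj_ofReal]
      ring
    change 0 ≤ (P * y s * star (y s) + v s * star (v s) +
        x * (u s * star (v s) + w s * star (P * y s) -
          ((P * w s + Q * y s) * star (y s) + u s * star (v s)))).re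
    rw [e, Complex.ofReal_re]
    have := Complex.normSq_nonneg (y s)
    have := Complex.normSq_nonneg (v s)
    positivity
  · simpa [hy0, hv0, hw0, hu0, sub_eq_add_neg] using hB
  · simp [hyt, hwt]

end Sturm

/-! ### Application to `F` -/

theorem F_eq_sol (a c ρ t : ℝ) (z : ℂ) :
    F a c ρ t z = cosSol (p a c ρ z) t + (a - c * ρ * z) / 2 * sinSol (p a c ρ z) t := by
  simp only [F, cosSol, sinSol]
  ring

theorem hasDerivAt_p (a c ρ : ℝ) (z : ℂ) :
    HasDerivAt (p a c ρ) (c ^ 2 - 2 * a * ρ * c - 2 * c ^ 2 * (1 - ρ ^ 2) * z) z := by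
  have h := ((((hasDerivAt_id z).const_mul ((ρ : ℂ) * c)).const_sub (a : ℂ)).pow 2).add
    (((hasDerivAt_id z).sub (hasDerivAt_pow 2 z)).const_mul ((c : ℂ) ^ 2))
  refine h.congr_deriv ?_
  simp only [id]
  push_cast
  ring

theorem hasDerivAt_F (a c ρ t : ℝ) (z : ℂ) :
    HasDerivAt (F a c ρ t)
      ((c ^ 2 - 2 * a * ρ * c - 2 * c ^ 2 * (1 - ρ ^ 2) * z) *
        (t * sinSol (p a c ρ z) t / 8 + (a - c * ρ * z) / 2 * sinSolParam (p a c ρ z) t) -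
        c * ρ / 2 * sinSol (p a c ρ z) t) z := by
  rw [funext (F_eq_sol a c ρ t)]
  have hp := hasDerivAt_p a c ρ z
  have h := ((hasDerivAt_cosSol_param (p a c ρ z) t).comp z hp).add
    (((((hasDerivAt_id z).const_mul ((c : ℂ) * ρ)).const_sub (a : ℂ)).div_const 2).mul
      ((hasDerivAt_sinSol_param (p a c ρ z) t).comp z hp))
  refine h.congr_deriv ?_
  simp only [id, Function.comp]
  ring

theorem differentiable_F (a c ρ t : ℝ) : Differentiable ℂ (F a c ρ t) := fun z =>
  (hasDerivAt_F a c ρ t z).differentiableAt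

theorem hasDerivAt_cosSol_add (q B : ℂ) (s : ℝ) :
    HasDerivAt (fun s : ℝ => cosSol q s + B * sinSol q s)
      (q / 4 * sinSol q s + B * cosSol q s) s :=
  ((hasDerivAt_cosSol q s).add ((hasDerivAt_sinSol q s).const_mul B)).comp_ofReal

theorem hasDerivAt_sinSol_add (q B : ℂ) (s : ℝ) :
    HasDerivAt (fun s : ℝ => q / 4 * sinSol q s + B * cosSol q s)
      (q / 4 * (cosSol q s + B * sinSol q s)) s := by
  refine (((hasDerivAt_sinSol q s).const_mul (q / 4)).add
    ((hasDerivAt_cosSol q s).const_mul B)).comp_ofReal.congr_deriv ?_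
  ring

theorem one_sub_sq_nonneg {ρ : ℝ} (hρ : ρ ∈ Set.Icc (-1 : ℝ) 1) : 0 ≤ 1 - ρ ^ 2 := by
  nlinarith [hρ.1, hρ.2]

theorem im_eq_zero_of_F_eq_zero {a c ρ t : ℝ} (ha : 0 < a) (hρ : ρ ∈ Set.Icc (-1 : ℝ) 1)
    (ht : 0 < t) {z : ℂ} (hF : F a c ρ t z = 0) : z.im = 0 := by
  by_contra hz
  rw [F_eq_sol] at hF
  have h1 := one_sub_sq_nonneg hρ
  refine solution_ne_zero (B := (a - c * ρ * z) / 2) (a := a / 2)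
    (γ := (a ^ 2 + c ^ 2 * (1 - ρ ^ 2) * normSq z) / 4) (z := z) hz
    (hasDerivAt_cosSol_add (p a c ρ z) _) (hasDerivAt_sinSol_add _ _)
    ?_ ?_ ?_ (by positivity) ?_ ?_ ht.le hF
  · simp [cosSol_zero, sinSol_zero]
  · simp [cosSol_zero, sinSol_zero]
  · have e : conj z * ((a - c * ρ * z) / 2) =
        ((a / 2 : ℝ) : ℂ) * conj z - ((c * ρ / 2 * normSq z : ℝ) : ℂ) := by
      push_cast
      rw [Complex.normSq_eq_conj_mul_self]
      ring
    rw [e, Complex.sub_im, Complex.ofReal_im, Complex.im_ofReal_mul, Complex.conj_im]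
    ring
  -- The factor `z̄` makes the linear term of `p` real, so its coefficient, of unknown sign, drops
  -- out.
  · have e : conj z * (p a c ρ z / 4) =
        ((a ^ 2 / 4 : ℝ) : ℂ) * conj z + (((c ^ 2 - 2 * a * ρ * c) / 4 * normSq z : ℝ) : ℂ) -
          ((c ^ 2 * (1 - ρ ^ 2) / 4 * normSq z : ℝ) : ℂ) * z := by
      push_cast
      rw [Complex.normSq_eq_conj_mul_self, p]
      ring
    rw [e, Complex.sub_im, Complex.add_im, Complex.ofReal_im, Complex.im_ofReal_mul,
      Complex.im_ofReal_mul, Complex.conj_im]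
    ring
  · have := Complex.normSq_nonneg z
    positivity

theorem deriv_F_ne_zero {a c ρ t : ℝ} (ha : 0 < a) (hρ : ρ ∈ Set.Icc (-1 : ℝ) 1)
    (ht : 0 < t) {x : ℝ} (hF : F a c ρ t x = 0) : deriv (F a c ρ t) x ≠ 0 := by
  rw [(hasDerivAt_F a c ρ t x).deriv]
  rw [F_eq_sol] at hF
  have h1 := one_sub_sq_nonneg hρ
  set q := p a c ρ x with hq
  have hqr : q / 4 = (((a - ρ * c * x) ^ 2 + c ^ 2 * (x - x ^ 2)) / 4 : ℝ) := by
    rw [hq, p]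
    push_cast
    ring
  set d : ℂ := c ^ 2 - 2 * a * ρ * c - 2 * c ^ 2 * (1 - ρ ^ 2) * x with hd
  have hdr : d / 4 = ((c ^ 2 - 2 * a * ρ * c - 2 * c ^ 2 * (1 - ρ ^ 2) * x) / 4 : ℝ) := by
    rw [hd]
    push_cast
    ring
  set B : ℂ := (a - c * ρ * x) / 2 with hB
  refine solution_param_ne_zero (x := x) (B := (a - c * ρ * x) / 2) (B' := -(c * ρ / 2))
    (w := fun s : ℝ => d * (s * sinSol q s / 8 + B * sinSolParam q s) - c * ρ / 2 * sinSol q s)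
    (u := fun s : ℝ => d * ((sinSol q s + s * cosSol q s) / 8 + B * (s * sinSol q s / 8)) -
      c * ρ / 2 * cosSol q s)
    (hasDerivAt_cosSol_add q B)
    (P := ((a - ρ * c * x) ^ 2 + c ^ 2 * (x - x ^ 2)) / 4)
    (Q := (c ^ 2 - 2 * a * ρ * c - 2 * c ^ 2 * (1 - ρ ^ 2) * x) / 4)
    (fun s => ?_) (fun s => ?_) (fun s => ?_) ?_ ?_ ?_ ?_ ?_ ?_ ht.le hF
  · rw [← hqr]
    exact hasDerivAt_sinSol_add q B s
  · have h := ((((((hasDerivAt_id (s : ℂ)).mul (hasDerivAt_sinSol q s)).div_const 8).add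
      ((hasDerivAt_sinSolParam q s).const_mul B)).const_mul d).sub
      ((hasDerivAt_sinSol q s).const_mul ((c : ℂ) * ρ / 2))).comp_ofReal
    refine h.congr_deriv ?_
    simp only [id]
    ring
  · have hS := hasDerivAt_sinSol q s
    have hC := hasDerivAt_cosSol q s
    have hid := hasDerivAt_id (s : ℂ)
    have h := (((((hS.add (hid.mul hC)).div_const 8).add
      (((hid.mul hS).div_const 8).const_mul B)).const_mul d).sub
      (hC.const_mul ((c : ℂ) * ρ / 2))).comp_ofReal
    refine h.congr_deriv ?_
    rw [← hqr, ← hdr]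
    simp only [id]
    linear_combination (-(d * B / 4)) * mul_sinSolParam q s
  · simp [cosSol_zero, sinSol_zero]
  · simp [cosSol_zero, sinSol_zero, hB]
  · simp [sinSolParam_zero, sinSol_zero]
  · simp [cosSol_zero, sinSol_zero]
  · linarith
  -- Likewise `P - xQ` removes the linear term and reverses the sign of the quadratic one.
  · have e : ((a - ρ * c * x) ^ 2 + c ^ 2 * (x - x ^ 2)) / 4 -
        x * ((c ^ 2 - 2 * a * ρ * c - 2 * c ^ 2 * (1 - ρ ^ 2) * x) / 4) =
        (a ^ 2 + c ^ 2 * (1 - ρ ^ 2) * x ^ 2) / 4 := by ring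
    rw [e]
    positivity

end Heston

theorem proposition5p1 (a c ρ t : ℝ) (ha : 0 < a) (hc : c ≠ 0) (hρ : ρ ∈ Set.Icc (-1 : ℝ) 1)
    (ht : 0 < t) :
    Differentiable ℂ (Heston.F a c ρ t) ∧
      ∀ z : ℂ, Heston.F a c ρ t z = 0 →
        z.im = 0 ∧ analyticOrderAt (Heston.F a c ρ t) z = 1 := by
  refine ⟨Heston.differentiable_F a c ρ t, fun z hz => ?_⟩
  have him := Heston.im_eq_zero_of_F_eq_zero ha hρ ht hz
  refine ⟨him, ?_⟩
  obtain ⟨x, rfl⟩ : ∃ x : ℝ, (x : ℂ) = z := ⟨z.re, Complex.ext rfl him.symm⟩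
  exact ((Heston.differentiable_F a c ρ t).analyticAt x).analyticOrderAt_eq_one_of_zero_deriv_ne_zero
    hz (Heston.deriv_F_ne_zero ha hρ ht hz)
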